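/- **Setting.** Let $\mathcal X$ be a (measurable) domain, $\mathcal Y$ a finite set of labels, and $\Phi$ a possibly infinite set of (measurable) features $\phi:\mathcal X\to\{\mathtt{true},\mathtt{false}\}$, closed under negation. A *component representation* of size $m\ge 1$ consists of components $G_1,\dots,G_m\subseteq\mathcal X$ covering $\mathcal X$ with labels $\ell(G_i)\in\mathcal Y$, a choice, for each $x$, of a component $G(x)\ni x$ (measurable in $x$), and, for all $i,j$ with $\ell(G_i)\ne\ell(G_j)$, a discriminative feature $\phi(G_i,G_j)\in\Phi$ that is true on $G_i$ and false on $G_j$, with $\phi(G_j,G_i)=\neg\phi(G_i,G_j)$. Its concept is $c^*(x)=\ell(G(x))$. In the *stochastic Discriminative Feature Feedback setting* with exception rate at most $\epsilon\in[0,1]$, each round is an independent draw from a fixed distribution, which determines an instance $x_t$, a label $y_t$ and whether the round is an exception; exceptions have probability at most $\epsilon$. The first round reveals $(x_0,y_0)$. In each later round $t$ the learner sees $x_t$, predicts a label $\hat y_t$ that was observed in an earlier round, and explains it by an instance $\hat x_t$ that was observed with label $\hat y_t$. If $\hat y_t=y_t$ there is no feedback; otherwise the teacher provides $y_t$ and a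 feature. In a round that is not an exception, $y_t=c^*(x_t)$, and the feature is $\phi(G(x_t),G(\hat x_t))$ whenever $c^*(x_t)\neq c^*(\hat x_t)$. In an exception, the instance, the label and the feature are unrestricted (the feature may depend, measurably, on the whole past). The *mistake rate* on a stream of length $n$ is the number of mistakes divided by $n$; the first round is counted as a mistake. **Claim.** There is a sample size $N(m,\alpha,\delta)\in\mathbb N$ such that, uniformly over integers $m\ge1$, $\alpha\in(0,1]$ and $\delta\in(0,1)$, $$N(m,\alpha,\delta)=\tilde O\!\left(\frac{m^4+\log(1/\delta)}{\alpha^3}\right),$$ where $\tilde O$ hides a universal constant and a fixed power of $\log\frac{2m}{\alpha\delta}$; more precisely, for some universal constants $C,k$, also $$N(m,\alpha,\delta)\le C\,\frac{m^4\log(2/\delta)}{\alpha^3}\,\log^k\frac{2m}{\alpha},$$ and the following hold. 1. For all $m\ge1$, $\alpha\in(0,1]$, $\delta\in(0,1)$, $\mathcal X$, $\mathcal Y$ there is a (not necessarily efficient) algorithm which, for every $\Phi$, every $\epsilon\in[0,1]$ and every stochastic setting as above with a representation of size $m$ and exception rate at most $\epsilon$, has mistake rate at most $\epsilon+\alpha$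 with probability at least $1-\delta$ over i.i.d. streams of length $n$, for every $n\ge N(m,\alpha,\delta)$. 2. The mistake rate converges to the exception rate: for all $m\ge1$, $\mathcal X$, $\mathcal Y$ there are algorithms $(L_n)_{n\ge 0}$ such that for all $\alpha,\delta>0$ there is $n_0$ such that for every $n\ge n_0$, for all $\Phi$, $\epsilon$ and settings as in 1, the mistake rate of $L_n$ on i.i.d. streams of length $n$ is at most $\epsilon+\alpha$ with probability at least $1-\delta$. -/

import Mathlib

universe u v w

open MeasureTheory

/-- A component representation of size `m` over the instance domain `X`, the label domain `Y` and
the set `Φ` of binary features. `comp x` is the index of the component `G(x)`, a chosen component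
that contains `x`; in particular the components cover `X`. For components `i`, `j` with different
labels, `disc i j` is the chosen discriminative feature `φ(Gᵢ, Gⱼ)`. -/
structure ComponentRepresentation (X Y : Type*) [MeasurableSpace X] (Φ : Set (X → Bool))
    (m : ℕ) where
  component : Fin m → Set X
  label : Fin m → Y
  comp : X → Fin m
  mem_component : ∀ x, x ∈ component (comp x)
  measurable_comp : Measurable comp
  disc : Fin m → Fin m → X → Bool
  disc_mem : ∀ i j, label i ≠ label j → disc i j ∈ Φ
  disc_true : ∀ i j, label i ≠ label j → ∀ x ∈ component i, disc i j x = true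
  disc_false : ∀ i j, label i ≠ label j → ∀ x ∈ component j, disc i j x = false
  disc_swap : ∀ i j, label i ≠ label j → disc j i = fun x => !disc i j x

/-- The target concept `c*(x) = ℓ(G(x))` of a representation. -/
def ComponentRepresentation.concept {X Y : Type*} [MeasurableSpace X] {Φ : Set (X → Bool)} {m : ℕ}
    (R : ComponentRepresentation X Y Φ m) (x : X) : Y :=
  R.label (R.comp x)

/-- A stochastic environment (i.i.d. source and teacher) which conforms to the Discriminative
Feature Feedback protocol with respect to a representation of size `m`, except for a rate of at
most `ε` of exceptions.

Each round draws an independent `z : Z` with law `μ`. It determines the presented instance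
`inst z`, the true label `lbl z` revealed by the teacher, and whether the round is an exception
(`z ∈ exc`); it may hold further hidden randomness.

`feedback t z past i` is the feature that the teacher gives in round `t + 1` (rounds are numbered
from `0`) if the learner errs there, where `z` lists the draws of rounds `0, …, t + 1`, the entry
`past s` is the round that the learner cited in round `s + 1`, and the learner now cites round `i`
(that is, it predicts the label seen in round `i` and explains this by the instance of round `i`).
In a round that is not an exception the label is `c*(x)` and the feature is `φ(G(x), G(x̂))`,
where `x` is the current and `x̂` the cited instance, whenever these components have different
labels, so that such a feature is part of the protocol. In an exception the instance, the label
and the feature are unrestricted, and may depend on the whole past. -/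
structure StochasticEnvironment (X Y Z : Type*) [MeasurableSpace X] [MeasurableSpace Y]
    [MeasurableSpace Z] (Φ : Set (X → Bool)) (m : ℕ) (ε : ℝ) where
  rep : ComponentRepresentation X Y Φ m
  μ : Measure Z
  isProbabilityMeasure : IsProbabilityMeasure μ
  inst : Z → X
  measurable_inst : Measurable inst
  lbl : Z → Y
  measurable_lbl : Measurable lbl
  exc : Set Z
  measurableSet_exc : MeasurableSet exc
  measure_exc_le : μ exc ≤ ENNReal.ofReal ε
  lbl_eq : ∀ z, z ∉ exc → lbl z = rep.concept (inst z)
  feedback : (t : ℕ) → (Fin (t + 2) → Z) → (Fin t → ℕ) → Fin (t + 1) → X → Bool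
  measurable_feedback : ∀ (t : ℕ) (past : Fin t → ℕ) (i : Fin (t + 1)),
    Measurable fun p : (Fin (t + 2) → Z) × X => feedback t p.1 past i p.2
  feedback_eq : ∀ (t : ℕ) (z : Fin (t + 2) → Z) (past : Fin t → ℕ) (i : Fin (t + 1)),
    z (Fin.last (t + 1)) ∉ exc →
    rep.concept (inst (z (Fin.last (t + 1)))) ≠ rep.concept (inst (z i.castSucc)) →
    feedback t z past i =
      rep.disc (rep.comp (inst (z (Fin.last (t + 1))))) (rep.comp (inst (z i.castSucc)))

attribute [instance] StochasticEnvironment.isProbabilityMeasure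

/-- What the learner knows about a completed round: the instance, its true label (provided by the
teacher after a mistake, and equal to the prediction otherwise), and the feature provided by the
teacher if there was a mistake. -/
structure Round (X Y : Type*) where
  inst : X
  label : Y
  feature : Option (X → Bool)

/-- A deterministic learning algorithm, with no restriction on its computational cost. Round `0`
only provides the first labeled example. In round `t + 1` the algorithm sees what happened in
rounds `0, …, t` and the new instance, and cites one of these earlier rounds: the label of
the cited round is its prediction, and the instance of the cited round, which was observed with
that label, is its explanation. -/
structure Learner (X Y : Type*) where
  cite : (t : ℕ) → (Fin (t + 1) → Round X Y) → X → Fin (t + 1)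

namespace StochasticEnvironment

variable {X Y Z : Type*} [MeasurableSpace X] [MeasurableSpace Y] [MeasurableSpace Z]
  {Φ : Set (X → Bool)} {m : ℕ} {ε : ℝ}

open Classical in
/-- The record of round `s + 1` on the stream `ω`, when round `i` is cited in it and `past` are the
citations before it. -/
noncomputable def round (E : StochasticEnvironment X Y Z Φ m ε) (ω : ℕ → Z) (s : ℕ)
    (past : Fin s → ℕ) (i : Fin (s + 1)) : Round X Y where
  inst := E.inst (ω (s + 1))
  label := E.lbl (ω (s + 1))
  feature :=
    if E.lbl (ω i) = E.lbl (ω (s + 1)) then none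
    else some (E.feedback s (fun j => ω j) past i)

/-- The interaction of the learner `L` with the environment on the stream `ω`: the records of rounds
`0, …, t`, and the rounds cited in rounds `1, …, t`. -/
noncomputable def interaction (E : StochasticEnvironment X Y Z Φ m ε) (L : Learner X Y)
    (ω : ℕ → Z) : (t : ℕ) → (Fin (t + 1) → Round X Y) × (Fin t → ℕ)
  | 0 => (fun _ => ⟨E.inst (ω 0), E.lbl (ω 0), none⟩, Fin.elim0)
  | t + 1 =>
    let h := interaction E L ω t
    let i := L.cite t h.1 (E.inst (ω (t + 1)))
    (Fin.snoc (α := fun _ => Round X Y) h.1 (E.round ω t h.2 i),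
      Fin.snoc (α := fun _ => ℕ) h.2 (i : ℕ))

/-- The round cited by the learner in round `t + 1`. -/
noncomputable def cited (E : StochasticEnvironment X Y Z Φ m ε) (L : Learner X Y) (ω : ℕ → Z)
    (t : ℕ) : Fin (t + 1) :=
  L.cite t (E.interaction L ω t).1 (E.inst (ω (t + 1)))

/-- The learner errs in round `t`. The opening round, where no prediction is possible, is counted
as a mistake. -/
def IsMistake (E : StochasticEnvironment X Y Z Φ m ε) (L : Learner X Y) (ω : ℕ → Z) : ℕ → Prop
  | 0 => True
  | t + 1 => E.lbl (ω (E.cited L ω t)) ≠ E.lbl (ω (t + 1))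

open Classical in
/-- The fraction of mistakes among the first `n` rounds. -/
noncomputable def mistakeRate (E : StochasticEnvironment X Y Z Φ m ε) (L : Learner X Y) (n : ℕ)
    (ω : ℕ → Z) : ℝ :=
  (((Finset.range n).filter (E.IsMistake L ω)).card : ℝ) / n

/-- The law of the i.i.d. stream of draws. -/
noncomputable def streamLaw (E : StochasticEnvironment X Y Z Φ m ε) : Measure (ℕ → Z) :=
  Measure.infinitePi fun _ => E.μ

end StochasticEnvironment

/-- With probability at least `1 - δ`, the learner `L` has mistake rate at most `ε + α` on i.i.d.
streams of length `n`, in every environment over the instance domain `X` and the label domain `Y`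
with a representation of size `m` and exception rate at most `ε`, for every `ε ∈ [0, 1]` and every
set `Φ` of (measurable) features closed under negation. -/
def Learner.Attains {X : Type u} {Y : Type v} [MeasurableSpace X] [MeasurableSpace Y]
    (L : Learner X Y) (m n : ℕ) (α δ : ℝ) : Prop :=
  ∀ (Z : Type w) [MeasurableSpace Z] (Φ : Set (X → Bool)),
    (∀ φ ∈ Φ, Measurable φ) → (∀ φ ∈ Φ, (fun x => !φ x) ∈ Φ) →
    ∀ ε : ℝ, 0 ≤ ε → ε ≤ 1 → ∀ E : StochasticEnvironment X Y Z Φ m ε,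
      E.streamLaw {ω | ε + α < E.mistakeRate L n ω} ≤ ENNReal.ofReal δ

/-! The learner explores, validates and commits. If round `t` is a regular draw from component `i`,
round `t + 1` a regular draw from `j`, and round `t + 1` cites round `t`, then the teacher reveals
`disc j i` whenever the labels differ. This feature is true on `j` and false on `i`. Call a
component frequent if its regular draws have probability at least `θ`. Once every ordered pair of
frequent components has appeared consecutively, a list of `m` rules exists among the recorded
rounds: rule `i` cites an instance of `i` and applies where all the features `disc j i` are false.
On an instance of a frequent component `j`, rule `j` applies, and no rule with another label does,
since its feature against `j` is true there. Such a list therefore errs only on exceptions and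
infrequent components, with probability at most `ε + m θ` (`exists_ruleList_error_le`).

The learner cannot tell which rounds to use, but only `T ^ (m + m ^ 2)` lists can be built from `T`
rounds. It picks the list with the fewest errors on `V` fresh rounds. Hoeffding's inequality
conditional on the first `T` draws (`infinitePi_card_visits_section_ge_le`), with a union bound over
lists, controls validation and all later rounds (`streamLaw_deviating_le`). The logarithm of the
number of lists is about `m ^ 2 log T`, so about `m ^ 2 / α ^ 2` rounds suffice up to logarithms.
Making these rounds a fraction `α / 5` of the stream costs the third factor `1 / α`. -/

/-! ### Independence and concentration for i.i.d. streams. -/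

section Streams

variable {Z : Type*}

/-- The stream that follows `p.1` before time `T` and `p.2` from then on. -/
def splice (T : ℕ) (p : (ℕ → Z) × (ℕ → Z)) (t : ℕ) : Z :=
  if t < T then p.1 t else p.2 t

theorem splice_of_lt {T t : ℕ} (h : t < T) (p : (ℕ → Z) × (ℕ → Z)) : splice T p t = p.1 t :=
  if_pos h

theorem splice_of_le {T t : ℕ} (h : T ≤ t) (p : (ℕ → Z) × (ℕ → Z)) : splice T p t = p.2 t :=
  if_neg h.not_gt

variable [MeasurableSpace Z]

theorem measurable_splice (T : ℕ) : Measurable (splice (Z := Z) T) := by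
  refine measurable_pi_lambda _ fun t => ?_
  unfold splice
  split_ifs <;> fun_prop

variable (μ : Measure Z) [IsProbabilityMeasure μ]

/-- Splicing two independent i.i.d. streams gives an i.i.d. stream. -/
theorem map_splice_infinitePi (T : ℕ) :
    ((Measure.infinitePi fun _ : ℕ => μ).prod (Measure.infinitePi fun _ : ℕ => μ)).map (splice T) =
      Measure.infinitePi fun _ : ℕ => μ := by
  refine Measure.eq_infinitePi _ fun s A hA => ?_
  rw [Measure.map_apply (measurable_splice T) (.pi s.countable_toSet fun i _ => hA i)]
  -- A box constrains `p.1` only at its coordinates before `T`, and `p.2` only at the others.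
  have h : splice T ⁻¹' Set.pi s A =
      Set.pi (s.filter (· < T)) A ×ˢ Set.pi (s.filter (¬ · < T)) A := by
    ext p
    simp only [Set.mem_preimage, Set.mem_pi, Set.mem_prod, Finset.coe_filter, Set.mem_ofPred_eq,
      Finset.mem_coe]
    constructor
    · refine fun h => ⟨fun i hi => ?_, fun i hi => ?_⟩
      · simpa [splice, hi.2] using h i hi.1
      · simpa [splice, hi.2] using h i hi.1
    · rintro ⟨h1, h2⟩ i hi
      by_cases hT : i < T
      · simpa [splice, hT] using h1 i ⟨hi, hT⟩
      · simpa [splice, hT] using h2 i ⟨hi, hT⟩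
  rw [h, Measure.prod_prod, Measure.infinitePi_pi _ (fun i _ => hA i),
    Measure.infinitePi_pi _ (fun i _ => hA i), Finset.prod_filter_mul_prod_filter_not]

open Classical in
/-- Hoeffding's inequality for the number of visits of an i.i.d. stream to a set. -/
theorem infinitePi_card_visits_ge_le {A : Set Z} (hA : MeasurableSet A) (S : Finset ℕ) {s : ℝ}
    (hs : 0 ≤ s) :
    Measure.infinitePi (fun _ : ℕ => μ)
        {ω | S.card * (μ.real A + s) ≤ ((S.filter fun t => ω t ∈ A).card : ℝ)} ≤
      ENNReal.ofReal (Real.exp (-2 * S.card * s ^ 2)) := by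
  set P := Measure.infinitePi (fun _ : ℕ => μ) with hP
  have hm : Measurable (A.indicator (fun _ => (1 : ℝ))) := measurable_const.indicator hA
  have hint : ∀ t, ∫ ω, A.indicator (fun _ => (1 : ℝ)) (ω t) ∂P = μ.real A := by
    intro t
    have h := (measurePreserving_eval_infinitePi (fun _ : ℕ => μ) t)
    rw [← integral_map (μ := P) (φ := fun ω : ℕ → Z => ω t) (measurable_pi_apply t).aemeasurable
      (f := A.indicator (fun _ => (1 : ℝ))) hm.aestronglyMeasurable]
    rw [show P.map (fun ω : ℕ → Z => ω t) = μ from h.map_eq]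
    simp [integral_indicator hA]
  have hind : ProbabilityTheory.iIndepFun
      (fun (t : ℕ) (ω : ℕ → Z) => A.indicator (fun _ => (1 : ℝ)) (ω t) - μ.real A) P :=
    ProbabilityTheory.iIndepFun_infinitePi
      (X := fun _ z => A.indicator (fun _ => (1 : ℝ)) z - μ.real A) fun _ => hm.sub_const _
  -- An indicator lies in `[0, 1]`, so its variance proxy is `1 / 4`; this gives the factor `2` in
  -- the exponent.
  have hsub : ∀ t ∈ S, ProbabilityTheory.HasSubgaussianMGF
      (fun ω : ℕ → Z => A.indicator (fun _ => (1 : ℝ)) (ω t) - μ.real A)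
      ((‖(1 : ℝ) - 0‖₊ / 2) ^ 2) P := by
    intro t _
    have := ProbabilityTheory.hasSubgaussianMGF_of_mem_Icc (μ := P) (a := 0) (b := 1)
      (X := fun ω : ℕ → Z => A.indicator (fun _ => (1 : ℝ)) (ω t))
      (hm.comp (measurable_pi_apply t)).aemeasurable
      (Filter.Eventually.of_forall fun ω => by
        by_cases h : ω t ∈ A <;> simp [h])
    rwa [hint t] at this
  have key := ProbabilityTheory.HasSubgaussianMGF.measure_sum_ge_le_of_iIndepFun hind hsub
    (ε := S.card * s) (by positivity)
  rw [← ENNReal.ofReal_toReal (measure_ne_top P _)]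
  refine ENNReal.ofReal_le_ofReal ((le_of_eq ?_).trans (key.trans (Real.exp_le_exp.2 ?_)))
  · change P.real _ = P.real _
    congr 1
    ext ω
    simp only [Set.mem_ofPred_eq, Finset.sum_sub_distrib, Finset.sum_const, nsmul_eq_mul]
    have : ∑ t ∈ S, A.indicator (fun _ => (1 : ℝ)) (ω t) = ((S.filter fun t => ω t ∈ A).card : ℝ) := by
      simp [Set.indicator_apply]
    rw [this]
    constructor <;> intro h <;> linarith
  · rcases Nat.eq_zero_or_pos S.card with h0 | h0
    · simp [h0]
    · have : (0 : ℝ) < S.card := by exact_mod_cast h0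
      refine le_of_eq ?_
      simp
      field_simp

open Classical in
/-- Hoeffding's inequality for the number of visits after time `T` to a set that is determined by
the draws before time `T`. -/
theorem infinitePi_card_visits_section_ge_le {D : Set ((ℕ → Z) × Z)} (hD : MeasurableSet D) {T : ℕ}
    (hT : ∀ ω ω' z, (∀ t < T, ω t = ω' t) → ((ω, z) ∈ D ↔ (ω', z) ∈ D))
    (S : Finset ℕ) (hS : ∀ t ∈ S, T ≤ t) {s : ℝ} (hs : 0 ≤ s) :
    Measure.infinitePi (fun _ : ℕ => μ)
        {ω | S.card * (μ.real (Prod.mk ω ⁻¹' D) + s) ≤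
          ((S.filter fun t => (ω, ω t) ∈ D).card : ℝ)} ≤
      ENNReal.ofReal (Real.exp (-2 * S.card * s ^ 2)) := by
  set P := Measure.infinitePi (fun _ : ℕ => μ) with hP
  have hmeas : MeasurableSet {ω : ℕ → Z | S.card * (μ.real (Prod.mk ω ⁻¹' D) + s) ≤
      ((S.filter fun t => (ω, ω t) ∈ D).card : ℝ)} := by
    have h1 : ∀ ω : ℕ → Z, ((S.filter fun t => (ω, ω t) ∈ D).card : ℝ) =
        ∑ t ∈ S, D.indicator (fun _ => (1 : ℝ)) (ω, ω t) := fun ω => by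
      simp [Set.indicator_apply]
    simp_rw [h1]
    refine measurableSet_le ?_ ?_
    · exact (((measurable_measure_prodMk_left (ν := μ) hD).ennreal_toReal).add_const s).const_mul _
    · refine Finset.measurable_sum _ fun t _ => ?_
      exact (measurable_const.indicator hD).comp (measurable_id.prodMk (measurable_pi_apply t))
  -- After splicing at `T`, fixing the first stream freezes the section of `D`, while the draws in
  -- `S` come from the independent second stream. The unconditional inequality then applies
  -- fibrewise.
  rw [hP, ← map_splice_infinitePi μ T, Measure.map_apply (measurable_splice T) hmeas,
    Measure.prod_apply (measurable_splice T hmeas)]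
  refine (lintegral_mono (g := fun _ => ENNReal.ofReal (Real.exp (-2 * S.card * s ^ 2)))
    fun ω => ?_).trans (by simp)
  have hsec : ∀ ω' z, (splice T (ω, ω'), z) ∈ D ↔ (ω, z) ∈ D := fun ω' z =>
    hT _ _ z fun t ht => splice_of_lt ht _
  refine le_of_eq_of_le ?_
    (infinitePi_card_visits_ge_le μ (A := Prod.mk ω ⁻¹' D) (measurable_prodMk_left hD) S hs)
  congr 1
  ext ω'
  simp only [Set.mem_preimage, Set.mem_ofPred_eq]
  have h1 : Prod.mk (splice T (ω, ω')) ⁻¹' D = Prod.mk ω ⁻¹' D := by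
    ext z
    exact hsec ω' z
  have h2 : (S.filter fun t => (splice T (ω, ω'), splice T (ω, ω') t) ∈ D) =
      S.filter fun t => (ω, ω' t) ∈ D := by
    refine Finset.filter_congr fun t ht => ?_
    rw [hsec, splice_of_le (hS t ht)]
  rw [h1, h2]

/-- The probability that none of `k` consecutive disjoint pairs of draws lies in `A ×ˢ B`. -/
theorem infinitePi_forall_pair_notMem {A B : Set Z} (hA : MeasurableSet A) (hB : MeasurableSet B)
    (k : ℕ) :
    Measure.infinitePi (fun _ : ℕ => μ)
        {ω | ∀ s < k, ¬ (ω (2 * s) ∈ A ∧ ω (2 * s + 1) ∈ B)} = (1 - μ A * μ B) ^ k := by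
  have hpair : ∀ s, MeasurableSet {ω : ℕ → Z | ω (2 * s) ∈ A ∧ ω (2 * s + 1) ∈ B} := fun s =>
    (measurable_pi_apply (2 * s) hA).inter (measurable_pi_apply (2 * s + 1) hB)
  have hk : ∀ k, MeasurableSet {ω : ℕ → Z | ∀ s < k, ¬ (ω (2 * s) ∈ A ∧ ω (2 * s + 1) ∈ B)} := by
    intro k
    have : {ω : ℕ → Z | ∀ s < k, ¬ (ω (2 * s) ∈ A ∧ ω (2 * s + 1) ∈ B)} =
        ⋂ s, ⋂ (_ : s < k), {ω : ℕ → Z | ω (2 * s) ∈ A ∧ ω (2 * s + 1) ∈ B}ᶜ := by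
      ext ω; simp
    rw [this]
    exact .iInter fun s => .iInter fun _ => (hpair s).compl
  induction k with
  | zero => simp
  | succ k ih =>
    -- Splicing at `2 * k` makes the last pair independent of the first `k` pairs.
    rw [← map_splice_infinitePi μ (2 * k), Measure.map_apply (measurable_splice _) (hk _)]
    have h : splice (2 * k) ⁻¹' {ω : ℕ → Z | ∀ s < k + 1, ¬ (ω (2 * s) ∈ A ∧ ω (2 * s + 1) ∈ B)} =
        {ω : ℕ → Z | ∀ s < k, ¬ (ω (2 * s) ∈ A ∧ ω (2 * s + 1) ∈ B)} ×ˢ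
          {ω : ℕ → Z | ω (2 * k) ∈ A ∧ ω (2 * k + 1) ∈ B}ᶜ := by
      ext p
      simp only [Set.mem_preimage, Set.mem_ofPred_eq, Set.mem_prod, Set.mem_compl_iff,
        Nat.lt_succ_iff_lt_or_eq, or_imp, forall_and, forall_eq]
      rw [splice_of_le le_rfl, splice_of_le (by omega)]
      refine and_congr_left fun _ => forall₂_congr fun s hs => ?_
      rw [splice_of_lt (by omega), splice_of_lt (by omega)]
    have hp : Measure.infinitePi (fun _ : ℕ => μ)
        {ω : ℕ → Z | ω (2 * k) ∈ A ∧ ω (2 * k + 1) ∈ B} = μ A * μ B := by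
      have := Measure.infinitePi_pi (fun _ : ℕ => μ) (s := {2 * k, 2 * k + 1})
        (t := fun i => if i = 2 * k then A else B)
        (fun i _ => by split_ifs <;> assumption)
      rw [Finset.prod_pair (by omega)] at this
      simp only [if_true, Nat.succ_ne_self, if_false] at this
      rw [← this]
      congr 1
      ext ω
      simp
    rw [h, Measure.prod_prod, ih, prob_compl_eq_one_sub (hpair k), hp, pow_succ]

end Streams

/-! ### Rule lists and the learner that validates them. -/

section Rules

variable {X Y : Type*} {m T : ℕ}

/-- A list of `m` rules built from the first `T` rounds. The rule `i` cites the round `h.1 i`; it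
applies to an instance that violates the features received in the rounds `h.2 i j`. -/
abbrev RuleList (m T : ℕ) := (Fin m → Fin T) × (Fin m → Fin m → Fin T)

/-- The rule `i` applies to `x`, when `r` lists the records of the rounds. -/
def RuleList.Applies (h : RuleList m T) (r : ℕ → Round X Y) (x : X) (i : Fin m) : Prop :=
  ∀ j, ∀ φ ∈ (r (h.2 i j)).feature, φ x = false

open Classical in
/-- The round cited when the set of rules that apply is `p`; it is round `0` if there are none. -/
noncomputable def RuleList.select (h : RuleList m T) (p : Fin m → Prop) : ℕ :=
  if hp : ∃ i, p i then h.1 hp.choose else 0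

/-- The round that the rule list cites on `x`, when `r` lists the records of the rounds. -/
noncomputable def RuleList.cite (h : RuleList m T) (r : ℕ → Round X Y) (x : X) : ℕ :=
  h.select (h.Applies r x)

theorem RuleList.cite_lt [NeZero T] (h : RuleList m T) (r : ℕ → Round X Y) (x : X) :
    h.cite r x < T := by
  unfold cite select
  split_ifs
  · exact Fin.is_lt _
  · exact Nat.pos_of_neZero T

theorem RuleList.cite_congr (h : RuleList m T) {r r' : ℕ → Round X Y} (hr : ∀ k < T, r k = r' k)
    (x : X) : h.cite r x = h.cite r' x := by
  have : h.Applies r x = h.Applies r' x := by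
    funext i
    simp only [Applies, hr _ (Fin.is_lt _)]
  rw [cite, cite, this]

/-- If some rule applies to `x`, then one of the applicable rules determines the cited round. -/
theorem RuleList.exists_applies_cite_eq (h : RuleList m T) {r : ℕ → Round X Y} {x : X}
    (hx : ∃ i, h.Applies r x i) : ∃ i, h.Applies r x i ∧ h.cite r x = h.1 i :=
  ⟨hx.choose, hx.choose_spec, dif_pos hx⟩

open Classical in
/-- The number of rounds in `T, …, T + V - 1` in which the rule list errs. -/
noncomputable def RuleList.validationErrors (V : ℕ) (r : ℕ → Round X Y) (h : RuleList m T) : ℕ :=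
  ((Finset.Ico T (T + V)).filter fun k =>
    (r (h.cite r (r k).inst)).label ≠ (r k).label).card

/-- A rule list with the fewest validation errors. -/
noncomputable def RuleList.best (m T V : ℕ) [NeZero T] (r : ℕ → Round X Y) : RuleList m T :=
  Function.argmin (RuleList.validationErrors V r)

theorem RuleList.best_congr [NeZero T] {V : ℕ} {r r' : ℕ → Round X Y}
    (hr : ∀ k < T + V, r k = r' k) : best m T V r = best m T V r' := by
  have : validationErrors (m := m) V r = validationErrors (T := T) V r' := by
    funext h
    unfold validationErrors
    congr 1
    ext k
    simp only [Finset.mem_filter]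
    refine and_congr_right fun hk => ?_
    have hlt := h.cite_lt r (r' k).inst
    rw [hr k (Finset.mem_Ico.1 hk).2, hr _ (by omega),
      h.cite_congr fun k hk => hr k (by omega)]
  rw [best, best, this]

/-- The learner that cites the previous round in all rounds before `T + V`, and then follows the
rule list from the first `T` rounds which errs least in the `V` rounds after these. -/
noncomputable def Learner.exploreThenCommit (X Y : Type*) (m T V : ℕ) [NeZero T] :
    Learner X Y where
  cite t hist x :=
    if T + V ≤ t + 1 then
      -- `Fin.ofNat` reduces modulo `t + 1`. All rounds consulted or cited here precede `T + V ≤ t +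
      -- 1`, so the reduction has no effect.
      Fin.ofNat (t + 1) ((RuleList.best m T V fun k => hist (Fin.ofNat (t + 1) k)).cite
        (fun k => hist (Fin.ofNat (t + 1) k)) x)
    else Fin.last t

end Rules

/-! ### The interaction of this learner with the environment, and measurability of its errors. -/

namespace StochasticEnvironment

variable {X Y Z : Type*} [MeasurableSpace X] [MeasurableSpace Y] [MeasurableSpace Z]
  {Φ : Set (X → Bool)} {m : ℕ} {ε : ℝ}

section Interaction

variable (E : StochasticEnvironment X Y Z Φ m ε) (L : Learner X Y) (ω : ℕ → Z)

/-- The record of round `t`. -/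
noncomputable def record (t : ℕ) : Round X Y :=
  (E.interaction L ω t).1 (Fin.last t)

theorem interaction_fst (t : ℕ) (i : Fin (t + 1)) :
    (E.interaction L ω t).1 i = E.record L ω i := by
  induction t with
  | zero =>
    obtain rfl : i = Fin.last 0 := Fin.ext (Nat.lt_one_iff.1 i.isLt)
    rfl
  | succ t ih =>
    induction i using Fin.lastCases with
    | last => rfl
    | cast i => simpa [interaction] using ih i

theorem interaction_snd (t : ℕ) (i : Fin t) :
    (E.interaction L ω t).2 i = E.cited L ω i := by
  induction t with
  | zero => exact i.elim0
  | succ t ih =>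
    induction i using Fin.lastCases with
    | last => simp [interaction, cited]
    | cast i => simpa [interaction] using ih i

theorem record_succ (t : ℕ) :
    E.record L ω (t + 1) = E.round ω t (fun s => E.cited L ω s) (E.cited L ω t) := by
  rw [← funext (E.interaction_snd L ω t)]
  simp [record, interaction, cited]

/-- The record of a round when every round cites the previous one. -/
noncomputable def chainRecord : ℕ → Round X Y
  | 0 => ⟨E.inst (ω 0), E.lbl (ω 0), none⟩
  | t + 1 => E.round ω t (fun s => s) (Fin.last t)

@[simp] theorem chainRecord_inst (k : ℕ) : (E.chainRecord ω k).inst = E.inst (ω k) := by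
  cases k <;> rfl

@[simp] theorem chainRecord_label (k : ℕ) : (E.chainRecord ω k).label = E.lbl (ω k) := by
  cases k <;> rfl

theorem chainRecord_congr {ω ω' : ℕ → Z} {T k : ℕ} (h : ∀ t < T, ω t = ω' t) (hk : k < T) :
    E.chainRecord ω k = E.chainRecord ω' k := by
  cases k with
  | zero => simp [chainRecord, h 0 hk]
  | succ t =>
    have h1 : (fun j : Fin (t + 2) => ω j) = fun j : Fin (t + 2) => ω' j :=
      funext fun j => h _ (by omega)
    have h2 : ω (Fin.last t) = ω' (Fin.last t) := h t (by omega)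
    simp only [chainRecord, round, h1]
    rw [h _ hk, h2]

theorem cited_exploreThenCommit_of_lt {T V t : ℕ} [NeZero T] (ht : t + 1 < T + V) :
    E.cited (Learner.exploreThenCommit X Y m T V) ω t = Fin.last t := by
  simp [cited, Learner.exploreThenCommit, ht.not_ge]

theorem record_exploreThenCommit {T V t : ℕ} [NeZero T] (ht : t < T + V) :
    E.record (Learner.exploreThenCommit X Y m T V) ω t = E.chainRecord ω t := by
  cases t with
  | zero => rfl
  | succ t =>
    rw [record_succ, cited_exploreThenCommit_of_lt _ _ ht, chainRecord]
    congr 1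
    funext s
    rw [cited_exploreThenCommit_of_lt _ _ (by omega), Fin.val_last]

/-- Before `T + V` the citations are fixed in advance, so the data behind the committed rules are
the chain records, which do not involve the learner. -/
theorem cited_exploreThenCommit_of_le {T V t : ℕ} [NeZero T] (ht : T + V ≤ t + 1) :
    (E.cited (Learner.exploreThenCommit X Y m T V) ω t : ℕ) =
      (RuleList.best m T V (E.chainRecord ω)).cite (E.chainRecord ω) (E.inst (ω (t + 1))) := by
  have h : ∀ k < T + V,
      (E.interaction (Learner.exploreThenCommit X Y m T V) ω t).1 (Fin.ofNat (t + 1) k) =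
        E.chainRecord ω k := by
    intro k hk
    have : ((Fin.ofNat (t + 1) k : Fin (t + 1)) : ℕ) = k := Nat.mod_eq_of_lt (by omega)
    rw [interaction_fst, this, record_exploreThenCommit _ _ hk]
  unfold cited
  conv_lhs => simp only [Learner.exploreThenCommit, if_pos ht]
  rw [Fin.val_ofNat]
  have h1 := RuleList.best_congr (m := m) h
  have h2 := fun g : RuleList m T => g.cite_congr (fun k (hk : k < T) => h k (by omega))
    (E.inst (ω (t + 1)))
  have := (RuleList.best m T V (E.chainRecord ω)).cite_lt (E.chainRecord ω) (E.inst (ω (t + 1)))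
  simp only [Learner.exploreThenCommit] at h1 h2
  rw [h1, h2, Nat.mod_eq_of_lt (by omega)]

end Interaction

/-- The pairs of a stream and a further draw such that the rule list, with the records of the
stream, errs on the draw. -/
def errorSet (E : StochasticEnvironment X Y Z Φ m ε) {T : ℕ} (h : RuleList m T) :
    Set ((ℕ → Z) × Z) :=
  {p | E.lbl (p.1 (h.cite (E.chainRecord p.1) (E.inst p.2))) ≠ E.lbl p.2}

/-- This is what allows conditioning on the first `T` draws. `T ≠ 0` is needed because the default
citation is round `0`. -/
theorem mem_errorSet_congr (E : StochasticEnvironment X Y Z Φ m ε) {T : ℕ} [NeZero T]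
    (h : RuleList m T) (ω ω' : ℕ → Z) (z : Z) (hω : ∀ t < T, ω t = ω' t) :
    (ω, z) ∈ E.errorSet h ↔ (ω', z) ∈ E.errorSet h := by
  simp only [errorSet, Set.mem_ofPred_eq]
  rw [h.cite_congr fun k hk => E.chainRecord_congr hω hk, hω _ (h.cite_lt _ _)]

/-- The set of applicable rules is a measurable function with values in a finite discrete space, so
the arbitrary choice made by `select` preserves measurability. -/
theorem measurableSet_errorSet [MeasurableSingletonClass Y] [Finite Y]
    (E : StochasticEnvironment X Y Z Φ m ε) {T : ℕ} (h : RuleList m T) :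
    MeasurableSet (E.errorSet h) := by
  have hlbl : ∀ k : ℕ, Measurable fun p : (ℕ → Z) × Z => E.lbl (p.1 k) := fun k =>
    E.measurable_lbl.comp ((measurable_pi_apply k).comp measurable_fst)
  have hround : ∀ k : ℕ, MeasurableSet {p : (ℕ → Z) × Z |
      ∀ φ ∈ (E.chainRecord p.1 k).feature, φ (E.inst p.2) = false} := by
    intro k
    cases k with
    | zero => simp [chainRecord]
    | succ t =>
      have : {p : (ℕ → Z) × Z |
          ∀ φ ∈ (E.chainRecord p.1 (t + 1)).feature, φ (E.inst p.2) = false} =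
          {p | E.lbl (p.1 t) = E.lbl (p.1 (t + 1))} ∪
          {p | E.feedback t (fun j => p.1 j) (fun s => s) (Fin.last t) (E.inst p.2) = false} := by
        ext p
        by_cases hp : E.lbl (p.1 t) = E.lbl (p.1 (t + 1)) <;> simp [chainRecord, round, hp]
      rw [this]
      refine (measurableSet_eq_fun (hlbl t) (hlbl (t + 1))).union ?_
      have hf : Measurable fun p : (ℕ → Z) × Z =>
          ((fun j : Fin (t + 2) => p.1 j, E.inst p.2) : (Fin (t + 2) → Z) × X) :=
        (measurable_pi_lambda _ fun j => (measurable_pi_apply _).comp measurable_fst).prodMk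
          (E.measurable_inst.comp measurable_snd)
      exact ((E.measurable_feedback t (fun s => s) (Fin.last t)).comp hf)
        (measurableSet_singleton false)
  have happ : Measurable fun p : (ℕ → Z) × Z =>
      h.Applies (E.chainRecord p.1) (E.inst p.2) := by
    refine measurable_pi_lambda _ fun i => measurableSet_setOfPred.1 ?_
    have : {p : (ℕ → Z) × Z | h.Applies (E.chainRecord p.1) (E.inst p.2) i} =
        ⋂ j, {p | ∀ φ ∈ (E.chainRecord p.1 (h.2 i j)).feature, φ (E.inst p.2) = false} := by
      ext p
      simp [RuleList.Applies]
    rw [this]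
    exact .iInter fun j => hround _
  have hcite : Measurable fun p : (ℕ → Z) × Z => h.cite (E.chainRecord p.1) (E.inst p.2) :=
    (Measurable.of_discrete (f := h.select)).comp happ
  have heval : Measurable fun q : ((ℕ → Z) × Z) × ℕ => E.lbl (q.1.1 q.2) :=
    measurable_from_prod_countable_left hlbl
  exact (measurableSet_eq_fun (heval.comp (measurable_id.prodMk hcite))
    (E.measurable_lbl.comp measurable_snd)).compl

end StochasticEnvironment

/-! ### Existence of a good rule list, and the mistake rate on typical streams. -/

namespace StochasticEnvironment

variable {X Y Z : Type*} [MeasurableSpace X] [MeasurableSpace Y] [MeasurableSpace Z]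
  {Φ : Set (X → Bool)} {m : ℕ} {ε : ℝ} (E : StochasticEnvironment X Y Z Φ m ε)

/-- The draws that are not exceptions and present an instance of the component `i`. -/
def regular (i : Fin m) : Set Z :=
  {z | z ∉ E.exc ∧ E.rep.comp (E.inst z) = i}

theorem measurableSet_regular (i : Fin m) : MeasurableSet (E.regular i) :=
  E.measurableSet_exc.compl.inter
    ((E.rep.measurable_comp.comp E.measurable_inst) (measurableSet_singleton i))

variable {E}

theorem lbl_eq_of_mem_regular {i : Fin m} {z : Z} (hz : z ∈ E.regular i) :
    E.lbl z = E.rep.label i := by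
  rw [E.lbl_eq z hz.1, ComponentRepresentation.concept, hz.2]

/-- If a regular round of the component `j` follows a regular round of the component `i` and cites
it, then there is no feedback if the labels agree, and the discriminative feature otherwise. -/
theorem mem_feature_chainRecord {ω : ℕ → Z} {t : ℕ} {i j : Fin m} (hi : ω t ∈ E.regular i)
    (hj : ω (t + 1) ∈ E.regular j) (φ : X → Bool) :
    φ ∈ (E.chainRecord ω (t + 1)).feature ↔
      E.rep.label i ≠ E.rep.label j ∧ E.rep.disc j i = φ := by
  have hi' := lbl_eq_of_mem_regular hi
  have hj' := lbl_eq_of_mem_regular hj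
  by_cases h : E.rep.label i = E.rep.label j
  · simp [chainRecord, round, hi', hj', h]
  · have hc : E.rep.concept (E.inst (ω (t + 1))) ≠ E.rep.concept (E.inst (ω t)) := by
      rw [← E.lbl_eq _ hi.1, ← E.lbl_eq _ hj.1, hi', hj']
      exact Ne.symm h
    have hf := E.feedback_eq t (fun j => ω j) (fun s => s) (Fin.last t) hj.1 hc
    simp only [Fin.val_last, Fin.val_castSucc, hi.2, hj.2] at hf
    simp [chainRecord, round, hi', hj', h, hf]

/-- A set that contains regular draws only from components of probability less than `θ` has
probability at most `ε + m θ`. -/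
theorem measureReal_le_of_disjoint_regular (hε : 0 ≤ ε) {θ : ℝ} (hθ : 0 ≤ θ) {A : Set Z}
    (hA : ∀ i, θ ≤ E.μ.real (E.regular i) → Disjoint A (E.regular i)) :
    E.μ.real A ≤ ε + m * θ := by
  classical
  have hsub : A ⊆ E.exc ∪ ⋃ i ∈ Finset.univ.filter fun i => E.μ.real (E.regular i) < θ,
      E.regular i := by
    intro z hz
    by_cases hexc : z ∈ E.exc
    · exact Or.inl hexc
    · have hz' : z ∈ E.regular (E.rep.comp (E.inst z)) := ⟨hexc, rfl⟩
      refine Or.inr (Set.mem_iUnion₂.2 ⟨_, ?_, hz'⟩)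
      rw [Finset.mem_filter]
      refine ⟨Finset.mem_univ _, lt_of_not_ge fun h => ?_⟩
      exact Set.disjoint_left.1 (hA _ h) hz hz'
  have h1 : E.μ.real E.exc ≤ ε := ENNReal.toReal_le_of_le_ofReal hε E.measure_exc_le
  calc E.μ.real A ≤ _ := measureReal_mono hsub
    _ ≤ _ := measureReal_union_le _ _
    _ ≤ ε + ∑ i ∈ Finset.univ.filter fun i => E.μ.real (E.regular i) < θ,
        E.μ.real (E.regular i) := add_le_add h1 (measureReal_biUnion_finset_le _ _)
    _ ≤ ε + ∑ i ∈ Finset.univ.filter fun i => E.μ.real (E.regular i) < θ, θ := by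
        gcongr with i hi
        exact (Finset.mem_filter.1 hi).2.le
    _ ≤ ε + m * θ := by
        rw [Finset.sum_const, nsmul_eq_mul]
        gcongr
        exact_mod_cast (Finset.card_filter_le _ _).trans_eq (by simp)

/-- If all pairs of components of probability at least `θ` show up consecutively, then some rule
list has error at most `ε + m θ`. -/
theorem exists_ruleList_error_le (hε : 0 ≤ ε) {θ : ℝ} (hθ : 0 ≤ θ) {K : ℕ} [NeZero (2 * K)]
    {ω : ℕ → Z}
    (hω : ∀ i j, θ ≤ E.μ.real (E.regular i) → θ ≤ E.μ.real (E.regular j) →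
      ∃ s < K, ω (2 * s) ∈ E.regular i ∧ ω (2 * s + 1) ∈ E.regular j) :
    ∃ h : RuleList m (2 * K), E.μ.real (Prod.mk ω ⁻¹' E.errorSet h) ≤ ε + m * θ := by
  classical
  by_cases hex : ∃ i, θ ≤ E.μ.real (E.regular i)
  swap
  · push Not at hex
    exact ⟨(fun _ => 0, fun _ _ => 0),
      measureReal_le_of_disjoint_regular hε hθ fun i hi => absurd hi (hex i).not_ge⟩
  obtain ⟨i₀, hi₀⟩ := hex
  -- Infrequent components may never appear, so `σ` replaces them by a fixed frequent one; every
  -- entry of the list can then be filled.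
  obtain ⟨σ, hσ, hσ'⟩ : ∃ σ : Fin m → Fin m, (∀ i, θ ≤ E.μ.real (E.regular (σ i))) ∧
      ∀ i, θ ≤ E.μ.real (E.regular i) → σ i = i := by
    refine ⟨fun i => if θ ≤ E.μ.real (E.regular i) then i else i₀, fun i => ?_, fun i hi => ?_⟩
    · dsimp only
      split_ifs with h
      exacts [h, hi₀]
    · exact if_pos hi
  choose s hs hs₁ hs₂ using fun i j => hω (σ i) (σ j) (hσ i) (hσ j)
  let h : RuleList m (2 * K) :=
    (fun i => ⟨2 * s i i, by have := hs i i; omega⟩,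
      fun i j => ⟨2 * s i j + 1, by have := hs i j; omega⟩)
  refine ⟨h, measureReal_le_of_disjoint_regular hε hθ fun j hj => ?_⟩
  have happ : ∀ x i, h.Applies (E.chainRecord ω) x i ↔
      ∀ j, E.rep.label (σ i) ≠ E.rep.label (σ j) → E.rep.disc (σ j) (σ i) x = false := by
    intro x i
    refine forall_congr' fun j => ?_
    change (∀ φ ∈ (E.chainRecord ω (2 * s i j + 1)).feature, φ x = false) ↔ _
    simp only [mem_feature_chainRecord (hs₁ i j) (hs₂ i j)]
    constructor
    · exact fun H hne => H _ ⟨hne, rfl⟩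
    · rintro H φ ⟨hne, rfl⟩
      exact H hne
  refine Set.disjoint_left.2 fun z hz hzj => hz ?_
  have hx := E.rep.mem_component (E.inst z)
  rw [hzj.2] at hx
  -- Rule `j` applies on component `j`, so the default citation is not used. The selected rule `i`
  -- may differ from `j`; only its label matters.
  obtain ⟨i, hi, hcite⟩ := h.exists_applies_cite_eq (r := E.chainRecord ω) (x := E.inst z)
    ⟨j, (happ _ _).2 fun k hk => by
      rw [hσ' j hj] at hk ⊢
      exact E.rep.disc_false _ _ hk.symm _ hx⟩
  change E.lbl (ω (h.cite (E.chainRecord ω) (E.inst z))) = E.lbl z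
  rw [hcite, lbl_eq_of_mem_regular hzj]
  change E.lbl (ω (2 * s i i)) = _
  rw [lbl_eq_of_mem_regular (hs₁ i i)]
  by_contra hne
  -- If the labels differed, rule `i` would require `disc j (σ i)` to be false at an instance of
  -- `j`, where it is true.
  have h1 := (happ _ _).1 hi j (by rwa [hσ' j hj])
  rw [hσ' j hj, E.rep.disc_true _ _ (Ne.symm hne) _ hx] at h1
  exact absurd h1 (by simp)

open Classical in
/-- The mistakes of the learner after the validation rounds are the errors of the chosen rules. -/
theorem card_mistakes_exploreThenCommit_le {T V : ℕ} [NeZero T] (ω : ℕ → Z) (n : ℕ) :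
    ((Finset.range n).filter
        (E.IsMistake (Learner.exploreThenCommit X Y m T V) ω)).card ≤
      T + V + ((Finset.Ico (T + V) n).filter fun t =>
        (ω, ω t) ∈ E.errorSet (RuleList.best m T V (E.chainRecord ω))).card := by
  refine (Finset.card_le_card (t := Finset.range (T + V) ∪ (Finset.Ico (T + V) n).filter fun t =>
    (ω, ω t) ∈ E.errorSet (RuleList.best m T V (E.chainRecord ω))) fun t ht => ?_).trans
    ((Finset.card_union_le _ _).trans (by simp))
  rw [Finset.mem_filter, Finset.mem_range] at ht
  rw [Finset.mem_union, Finset.mem_range, Finset.mem_filter, Finset.mem_Ico]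
  refine (lt_or_ge t (T + V)).imp_right fun hle => ⟨⟨hle, ht.1⟩, ?_⟩
  obtain ⟨t, rfl⟩ : ∃ k, t = k + 1 :=
    ⟨t - 1, by have := Nat.pos_of_neZero T; omega⟩
  have := ht.2
  simp only [IsMistake] at this
  rwa [cited_exploreThenCommit_of_le _ _ hle] at this

open Classical in
theorem validationErrors_chainRecord {T V : ℕ} (ω : ℕ → Z) (h : RuleList m T) :
    h.validationErrors V (E.chainRecord ω) =
      ((Finset.Ico T (T + V)).filter fun t => (ω, ω t) ∈ E.errorSet h).card := by
  unfold RuleList.validationErrors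
  congr 1
  ext k
  simp only [Finset.mem_filter, chainRecord_inst, chainRecord_label]
  rfl

/-- On streams on which error frequencies of all rule lists are close to their probabilities,
and some rule list has a small error, the learner has a small mistake rate. -/
theorem mistakeRate_exploreThenCommit_le {T V n : ℕ} [NeZero T] {ω : ℕ → Z} {e s η : ℝ}
    (hε : 0 ≤ e + 3 * s) (hn : ((T + V : ℕ) : ℝ) ≤ η * n) (hle : T + V ≤ n)
    (hbest : ∃ h : RuleList m T, E.μ.real (Prod.mk ω ⁻¹' E.errorSet h) ≤ e)
    (h₁ : open Classical in ∀ h : RuleList m T,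
      (((Finset.Ico T (T + V)).filter fun t => (ω, ω t) ∈ E.errorSet h).card : ℝ) ≤
        V * (E.μ.real (Prod.mk ω ⁻¹' E.errorSet h) + s))
    (h₂ : open Classical in ∀ h : RuleList m T,
      V * (E.μ.real (Prod.mk ω ⁻¹' E.errorSet h) - s) <
        (((Finset.Ico T (T + V)).filter fun t => (ω, ω t) ∈ E.errorSet h).card : ℝ))
    (h₃ : open Classical in ∀ h : RuleList m T,
      (((Finset.Ico (T + V) n).filter fun t => (ω, ω t) ∈ E.errorSet h).card : ℝ) ≤
        ((n - (T + V) : ℕ) : ℝ) * (E.μ.real (Prod.mk ω ⁻¹' E.errorSet h) + s)) :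
    E.mistakeRate (Learner.exploreThenCommit X Y m T V) n ω ≤ e + 3 * s + η := by
  classical
  obtain ⟨h, hh⟩ := hbest
  set g := RuleList.best m T V (E.chainRecord ω) with hg
  have hmin : g.validationErrors V (E.chainRecord ω) ≤ h.validationErrors V (E.chainRecord ω) :=
    Function.argmin_le _ _
  rw [validationErrors_chainRecord, validationErrors_chainRecord] at hmin
  have hmin' := (h₂ g).trans_le ((Nat.cast_le (α := ℝ)).2 hmin |>.trans (h₁ h))
  have hg' : E.μ.real (Prod.mk ω ⁻¹' E.errorSet g) ≤ e + 2 * s := by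
    -- The strict inequality in `h₂` lets the factor `V` cancel without assuming `V > 0`.
    have := lt_of_mul_lt_mul_left hmin' (Nat.cast_nonneg V)
    linarith
  have hcard : (((Finset.range n).filter
      (E.IsMistake (Learner.exploreThenCommit X Y m T V) ω)).card : ℝ) ≤ (e + 3 * s + η) * n := by
    have h4 := (Nat.cast_le (α := ℝ)).2
      (card_mistakes_exploreThenCommit_le (E := E) (T := T) (V := V) ω n)
    rw [Nat.cast_add] at h4
    -- The list `g` depends on the validation draws; `h₃` still covers it, being uniform over all
    -- lists.
    calc _ ≤ _ := h4
      _ ≤ η * n + ((n - (T + V) : ℕ) : ℝ) * (e + 2 * s + s) :=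
          add_le_add hn ((h₃ g).trans (by gcongr))
      _ ≤ η * n + n * (e + 2 * s + s) := by
          have : 0 ≤ e + 2 * s + s := by linarith
          gcongr
          exact Nat.sub_le _ _
      _ = _ := by ring
  have hpos : (0 : ℝ) < n := by
    have := Nat.pos_of_neZero T
    exact_mod_cast (by omega : 0 < n)
  rw [mistakeRate, div_le_iff₀ hpos]
  exact hcard

/-- The probability that some pair of components of probability at least `θ` does not show up
consecutively in the first `2 K` rounds. -/
theorem streamLaw_missing_pair_le {θ : ℝ} (hθ : 0 ≤ θ) (K : ℕ) :
    E.streamLaw {ω | ∃ i j, θ ≤ E.μ.real (E.regular i) ∧ θ ≤ E.μ.real (E.regular j) ∧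
        ∀ s < K, ¬ (ω (2 * s) ∈ E.regular i ∧ ω (2 * s + 1) ∈ E.regular j)} ≤
      ENNReal.ofReal (m ^ 2 * Real.exp (-(K * θ ^ 2))) := by
  have hsub : {ω : ℕ → Z | ∃ i j, θ ≤ E.μ.real (E.regular i) ∧ θ ≤ E.μ.real (E.regular j) ∧
        ∀ s < K, ¬ (ω (2 * s) ∈ E.regular i ∧ ω (2 * s + 1) ∈ E.regular j)} ⊆
      ⋃ q : Fin m × Fin m, {ω | θ ≤ E.μ.real (E.regular q.1) ∧ θ ≤ E.μ.real (E.regular q.2) ∧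
        ∀ s < K, ¬ (ω (2 * s) ∈ E.regular q.1 ∧ ω (2 * s + 1) ∈ E.regular q.2)} := by
    rintro ω ⟨i, j, h⟩
    exact Set.mem_iUnion.2 ⟨(i, j), h⟩
  have hq : ∀ q : Fin m × Fin m, E.streamLaw
      {ω | θ ≤ E.μ.real (E.regular q.1) ∧ θ ≤ E.μ.real (E.regular q.2) ∧
        ∀ s < K, ¬ (ω (2 * s) ∈ E.regular q.1 ∧ ω (2 * s + 1) ∈ E.regular q.2)} ≤
      ENNReal.ofReal (Real.exp (-(K * θ ^ 2))) := by
    intro q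
    by_cases h : θ ≤ E.μ.real (E.regular q.1) ∧ θ ≤ E.μ.real (E.regular q.2)
    swap
    · have : {ω : ℕ → Z | θ ≤ E.μ.real (E.regular q.1) ∧ θ ≤ E.μ.real (E.regular q.2) ∧
          ∀ s < K, ¬ (ω (2 * s) ∈ E.regular q.1 ∧ ω (2 * s + 1) ∈ E.regular q.2)} = ∅ :=
        Set.eq_empty_of_forall_notMem fun ω hω => h ⟨hω.1, hω.2.1⟩
      rw [this, measure_empty]
      exact zero_le
    refine (measure_mono (t := {ω : ℕ → Z | ∀ s < K,
      ¬ (ω (2 * s) ∈ E.regular q.1 ∧ ω (2 * s + 1) ∈ E.regular q.2)}) fun ω hω => hω.2.2).trans ?_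
    rw [streamLaw, infinitePi_forall_pair_notMem E.μ (E.measurableSet_regular _)
      (E.measurableSet_regular _)]
    have h1 : ENNReal.ofReal (θ ^ 2) ≤ E.μ (E.regular q.1) * E.μ (E.regular q.2) := by
      rw [pow_two, ENNReal.ofReal_mul hθ]
      exact mul_le_mul' (ENNReal.ofReal_le_of_le_toReal h.1) (ENNReal.ofReal_le_of_le_toReal h.2)
    calc (1 - E.μ (E.regular q.1) * E.μ (E.regular q.2)) ^ K
        ≤ (ENNReal.ofReal (Real.exp (-θ ^ 2))) ^ K := by
          gcongr
          refine (tsub_le_tsub_left h1 1).trans ?_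
          rw [← ENNReal.ofReal_one, ← ENNReal.ofReal_sub _ (sq_nonneg θ)]
          refine ENNReal.ofReal_le_ofReal ?_
          linarith [Real.add_one_le_exp (-θ ^ 2)]
      _ = ENNReal.ofReal (Real.exp (-(K * θ ^ 2))) := by
          rw [← ENNReal.ofReal_pow (Real.exp_nonneg _), ← Real.exp_nat_mul]
          congr 2
          ring
  calc _ ≤ _ := measure_mono hsub
    _ ≤ ∑ q : Fin m × Fin m, ENNReal.ofReal (Real.exp (-(K * θ ^ 2))) :=
        (measure_iUnion_fintype_le _ _).trans (Finset.sum_le_sum fun q _ => hq q)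
    _ = _ := by
        rw [Finset.sum_const, nsmul_eq_mul, ENNReal.ofReal_mul (by positivity)]
        simp [pow_two]

end StochasticEnvironment

/-! ### Uniform deviation bounds over all rule lists. -/

namespace StochasticEnvironment

variable {X Y Z : Type*} [MeasurableSpace X] [MeasurableSpace Y] [MeasurableSpace Z]
  {Φ : Set (X → Bool)} {m : ℕ} {ε : ℝ} (E : StochasticEnvironment X Y Z Φ m ε)

/-- The streams on which some rule list built from the first `T` rounds has an error frequency in
the rounds `T, …, T + V - 1` or `T + V, …, n - 1` that is far from its error probability. -/
def deviating (T V n : ℕ) (s : ℝ) : Set (ℕ → Z) :=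
  open Classical in
  ⋃ h : RuleList m T,
    {ω | (Finset.Ico T (T + V)).card * (E.μ.real (Prod.mk ω ⁻¹' E.errorSet h) + s) ≤
      (((Finset.Ico T (T + V)).filter fun t => (ω, ω t) ∈ E.errorSet h).card : ℝ)} ∪
    -- An upper deviation for the complement is a lower deviation for the error set.
    ({ω | (Finset.Ico T (T + V)).card * (E.μ.real (Prod.mk ω ⁻¹' (E.errorSet h)ᶜ) + s) ≤
      (((Finset.Ico T (T + V)).filter fun t => (ω, ω t) ∈ (E.errorSet h)ᶜ).card : ℝ)} ∪
    {ω | (Finset.Ico (T + V) n).card * (E.μ.real (Prod.mk ω ⁻¹' E.errorSet h) + s) ≤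
      (((Finset.Ico (T + V) n).filter fun t => (ω, ω t) ∈ E.errorSet h).card : ℝ)})

theorem streamLaw_deviating_le [MeasurableSingletonClass Y] [Finite Y] {T V n : ℕ} [NeZero T]
    (hn : T + V + V ≤ n) {s : ℝ} (hs : 0 ≤ s) :
    E.streamLaw (E.deviating T V n s) ≤
      ENNReal.ofReal (T ^ (m + m ^ 2) * (3 * Real.exp (-(2 * V * s ^ 2)))) := by
  have hcard : Fintype.card (RuleList m T) = T ^ (m + m ^ 2) := by
    simp [RuleList, pow_add, ← pow_mul, pow_two]
  have hn' : (V : ℝ) ≤ ((n - (T + V) : ℕ) : ℝ) := by exact_mod_cast (by omega)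
  calc E.streamLaw (E.deviating T V n s)
      ≤ ∑ h : RuleList m T, ENNReal.ofReal (3 * Real.exp (-(2 * V * s ^ 2))) := by
        refine (measure_iUnion_fintype_le _ _).trans (Finset.sum_le_sum fun h _ => ?_)
        rw [streamLaw]
        have hD := E.measurableSet_errorSet h
        have hc := E.mem_errorSet_congr h
        have h1 := infinitePi_card_visits_section_ge_le E.μ hD hc (Finset.Ico T (T + V))
          (fun t ht => (Finset.mem_Ico.1 ht).1) hs
        have h2 := infinitePi_card_visits_section_ge_le E.μ hD.compl
          (fun ω ω' z hω => not_congr (hc ω ω' z hω)) (Finset.Ico T (T + V))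
          (fun t ht => (Finset.mem_Ico.1 ht).1) hs
        have h3 := infinitePi_card_visits_section_ge_le E.μ hD hc (Finset.Ico (T + V) n)
          (fun t ht => le_of_add_le_left (Finset.mem_Ico.1 ht).1) hs
        have e1 : Real.exp (-2 * (Finset.Ico T (T + V)).card * s ^ 2) =
            Real.exp (-(2 * V * s ^ 2)) := by
          rw [Nat.card_Ico, Nat.add_sub_cancel_left]
          congr 1
          ring
        -- At least `V` rounds remain after commitment, so the validation exponent bounds this tail
        -- as well.
        have e3 : Real.exp (-2 * (Finset.Ico (T + V) n).card * s ^ 2) ≤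
            Real.exp (-(2 * V * s ^ 2)) := by
          rw [Nat.card_Ico]
          refine Real.exp_le_exp.2 ?_
          nlinarith [mul_le_mul_of_nonneg_right hn' (sq_nonneg s)]
        rw [e1] at h1 h2
        refine (measure_union_le _ _).trans ((add_le_add h1 ((measure_union_le _ _).trans
          (add_le_add (le_of_eq_of_le ?_ h2)
            (h3.trans (ENNReal.ofReal_le_ofReal e3))))).trans_eq ?_)
        · congr!
        rw [← ENNReal.ofReal_add (by positivity) (by positivity),
          ← ENNReal.ofReal_add (by positivity) (by positivity)]
        congr 1
        ring
    _ = _ := by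
        rw [Finset.sum_const, nsmul_eq_mul, Finset.card_univ, hcard,
          ENNReal.ofReal_mul (p := (T : ℝ) ^ (m + m ^ 2)) (by positivity),
          ENNReal.ofReal_pow (Nat.cast_nonneg _), ENNReal.ofReal_natCast, Nat.cast_pow]

variable {E}

theorem mistakeRate_exploreThenCommit_le_of_notMem_deviating [MeasurableSingletonClass Y]
    [Finite Y] {T V n : ℕ} [NeZero T] {ω : ℕ → Z} {e s η : ℝ}
    (hε : 0 ≤ e + 3 * s) (hn : ((T + V : ℕ) : ℝ) ≤ η * n) (hle : T + V ≤ n)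
    (hbest : ∃ h : RuleList m T, E.μ.real (Prod.mk ω ⁻¹' E.errorSet h) ≤ e)
    (hω : ω ∉ E.deviating T V n s) :
    E.mistakeRate (Learner.exploreThenCommit X Y m T V) n ω ≤ e + 3 * s + η := by
  classical
  simp only [deviating, Set.mem_iUnion, Set.mem_union, Set.mem_ofPred_eq, not_exists, not_or,
    not_le, Nat.card_Ico, Nat.add_sub_cancel_left] at hω
  refine mistakeRate_exploreThenCommit_le hε hn hle hbest (fun h => (hω h).1.le)
    (fun h => ?_) (fun h => (hω h).2.2.le)
  have h2 := (hω h).2.1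
  rw [Set.preimage_compl, probReal_compl_eq_one_sub
    (measurable_prodMk_left (E.measurableSet_errorSet h))] at h2
  have h3 := Finset.card_filter_add_card_filter_not (s := Finset.Ico T (T + V))
    (fun t => (ω, ω t) ∈ E.errorSet h)
  rw [Nat.card_Ico, Nat.add_sub_cancel_left] at h3
  have h4 : ((((Finset.Ico T (T + V)).filter fun t => (ω, ω t) ∈ E.errorSet h).card : ℝ)) +
      (((Finset.Ico T (T + V)).filter fun t => (ω, ω t) ∈ (E.errorSet h)ᶜ).card : ℝ) = V := by
    exact_mod_cast h3
  linarith

end StochasticEnvironment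

/-! ### From error budgets to the guarantee. -/

/-- Sufficient conditions on the numbers of exploration and validation rounds. -/
theorem Learner.attains_exploreThenCommit {X : Type u} {Y : Type v} [MeasurableSpace X]
    [MeasurableSpace Y] [MeasurableSingletonClass Y] [Finite Y] {m K V n : ℕ} [NeZero (2 * K)]
    {α δ : ℝ} (hm : 1 ≤ m) (hα : 0 < α) (hα₁ : α ≤ 1)
    (hK : (m : ℝ) ^ 2 * Real.exp (-(K * (α / (5 * m)) ^ 2)) ≤ δ / 2)
    (hV : ((2 * K : ℕ) : ℝ) ^ (m + m ^ 2) * (3 * Real.exp (-(2 * V * (α / 5) ^ 2))) ≤ δ / 2)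
    (hn : ((2 * K + V : ℕ) : ℝ) ≤ α / 5 * n) :
    Learner.Attains.{u, v, w} (Learner.exploreThenCommit X Y m (2 * K) V) m n α δ := by
  intro Z _ Φ _ _ ε hε _ E
  have hm' : (0 : ℝ) < m := by exact_mod_cast hm
  have hn' : 2 * K + V + V ≤ n := by
    have : ((2 * K + V + V : ℕ) : ℝ) ≤ n := by
      push_cast at hn ⊢
      have := mul_le_mul_of_nonneg_right hα₁ (Nat.cast_nonneg (α := ℝ) n)
      have h1 := Nat.cast_nonneg (α := ℝ) K
      have h2 := Nat.cast_nonneg (α := ℝ) V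
      linarith
    exact_mod_cast this
  have hθ : 0 ≤ α / (5 * m) := by positivity
  have hbad : {ω | ε + α < E.mistakeRate (Learner.exploreThenCommit X Y m (2 * K) V) n ω} ⊆
      {ω | ∃ i j, α / (5 * m) ≤ E.μ.real (E.regular i) ∧ α / (5 * m) ≤ E.μ.real (E.regular j) ∧
        ∀ s < K, ¬ (ω (2 * s) ∈ E.regular i ∧ ω (2 * s + 1) ∈ E.regular j)} ∪
      E.deviating (2 * K) V n (α / 5) := by
    intro ω hω
    by_contra hcon
    rw [Set.mem_union, not_or] at hcon
    obtain ⟨h1, h2⟩ := hcon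
    have h1' : ∀ i j, α / (5 * m) ≤ E.μ.real (E.regular i) →
        α / (5 * m) ≤ E.μ.real (E.regular j) →
        ∃ s < K, ω (2 * s) ∈ E.regular i ∧ ω (2 * s + 1) ∈ E.regular j := by
      intro i j hi hj
      by_contra h
      push Not at h
      exact h1 ⟨i, j, hi, hj, fun s hs hc => h s hs hc.1 hc.2⟩
    -- The excess `α` splits into `α / 5` for infrequent components, `3 α / 5` for deviations (two
    -- in validation, one after it) and `α / 5` for the rounds before commitment.
    have h3 := StochasticEnvironment.mistakeRate_exploreThenCommit_le_of_notMem_deviating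
      (η := α / 5) (by positivity) hn (by omega)
      (StochasticEnvironment.exists_ruleList_error_le hε hθ h1') h2
    have h4 : (m : ℝ) * (α / (5 * m)) = α / 5 := by field_simp
    rw [Set.mem_ofPred_eq] at hω
    linarith
  refine (measure_mono hbad).trans ((measure_union_le _ _).trans ?_)
  have hδ : 0 ≤ δ / 2 := le_trans (by positivity) hV
  calc _ ≤ ENNReal.ofReal (δ / 2) + ENNReal.ofReal (δ / 2) :=
        add_le_add ((StochasticEnvironment.streamLaw_missing_pair_le hθ K).trans
            (ENNReal.ofReal_le_ofReal hK))
          ((E.streamLaw_deviating_le hn' (by positivity)).trans (ENNReal.ofReal_le_ofReal hV))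
    _ = ENNReal.ofReal δ := by
        rw [← ENNReal.ofReal_add hδ hδ, add_halves]

theorem Learner.Attains.mono {X : Type u} {Y : Type v} [MeasurableSpace X] [MeasurableSpace Y]
    {L : Learner X Y} {m n : ℕ} {α α' δ δ' : ℝ} (h : Learner.Attains.{u, v, w} L m n α δ)
    (hα : α ≤ α') (hδ : δ ≤ δ') : Learner.Attains.{u, v, w} L m n α' δ' := by
  intro Z _ Φ h1 h2 ε hε hε' E
  refine (measure_mono fun ω hω => ?_).trans
    ((h Z Φ h1 h2 ε hε hε' E).trans (ENNReal.ofReal_le_ofReal hδ))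
  rw [Set.mem_ofPred_eq] at hω ⊢
  linarith

/-! ### Explicit sample sizes and their growth. -/

/-- The number of pairs of exploration rounds. -/
noncomputable def explorationSize (m : ℕ) (α δ : ℝ) : ℕ :=
  ⌈25 * m ^ 2 / α ^ 2 * Real.log (2 * m ^ 2 / δ)⌉₊

/-- The number of validation rounds after `T` exploration rounds. -/
noncomputable def validationSize (m : ℕ) (α δ : ℝ) (T : ℕ) : ℕ :=
  ⌈25 / (2 * α ^ 2) * Real.log (6 * T ^ (m + m ^ 2) / δ)⌉₊

/-- A sufficient length of the stream. -/
noncomputable def streamSize (m : ℕ) (α δ : ℝ) : ℕ :=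
  ⌈5 / α * ((2 * explorationSize m α δ +
    validationSize m α δ (2 * explorationSize m α δ) : ℕ) : ℝ)⌉₊

section SampleSize

variable {m : ℕ} {α δ : ℝ}

theorem explorationSize_pos (hm : 1 ≤ m) (hα : 0 < α) (hδ : 0 < δ) (hδ₁ : δ < 1) :
    0 < explorationSize m α δ := by
  have hm' : (1 : ℝ) ≤ m := by exact_mod_cast hm
  refine Nat.ceil_pos.2 (mul_pos (by positivity) (Real.log_pos ?_))
  rw [lt_div_iff₀ hδ]
  nlinarith

/-- Before rounding up, the size solves this bound with equality for the threshold `θ = α / (5 m)`.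
-/
theorem mul_exp_explorationSize_le (hm : 1 ≤ m) (hα : 0 < α) (hδ : 0 < δ) :
    (m : ℝ) ^ 2 * Real.exp (-(explorationSize m α δ * (α / (5 * m)) ^ 2)) ≤ δ / 2 := by
  have hm' : (0 : ℝ) < m := by exact_mod_cast hm
  have h := Nat.le_ceil (25 * m ^ 2 / α ^ 2 * Real.log (2 * m ^ 2 / δ))
  have h1 : Real.log (2 * m ^ 2 / δ) ≤ explorationSize m α δ * (α / (5 * m)) ^ 2 := by
    calc Real.log (2 * m ^ 2 / δ) =
        25 * m ^ 2 / α ^ 2 * Real.log (2 * m ^ 2 / δ) * (α / (5 * m)) ^ 2 := by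
          field_simp
          ring
      _ ≤ _ := mul_le_mul_of_nonneg_right h (sq_nonneg _)
  calc (m : ℝ) ^ 2 * Real.exp (-(explorationSize m α δ * (α / (5 * m)) ^ 2))
      ≤ (m : ℝ) ^ 2 * Real.exp (-Real.log (2 * m ^ 2 / δ)) := by gcongr
    _ = δ / 2 := by
      rw [Real.exp_neg, Real.exp_log (by positivity)]
      field_simp

theorem mul_exp_validationSize_le (hα : 0 < α) (hδ : 0 < δ) {T : ℕ} (hT : 0 < T) :
    (T : ℝ) ^ (m + m ^ 2) * (3 * Real.exp (-(2 * validationSize m α δ T * (α / 5) ^ 2))) ≤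
      δ / 2 := by
  have hT' : (0 : ℝ) < T := by exact_mod_cast hT
  have h := Nat.le_ceil (25 / (2 * α ^ 2) * Real.log (6 * T ^ (m + m ^ 2) / δ))
  have h1 : Real.log (6 * T ^ (m + m ^ 2) / δ) ≤ 2 * validationSize m α δ T * (α / 5) ^ 2 := by
    calc Real.log (6 * T ^ (m + m ^ 2) / δ) =
        25 / (2 * α ^ 2) * Real.log (6 * T ^ (m + m ^ 2) / δ) * (2 * (α / 5) ^ 2) := by
          field_simp
          ring
      _ ≤ validationSize m α δ T * (2 * (α / 5) ^ 2) :=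
          mul_le_mul_of_nonneg_right h (by positivity)
      _ = _ := by ring
  calc (T : ℝ) ^ (m + m ^ 2) * (3 * Real.exp (-(2 * validationSize m α δ T * (α / 5) ^ 2)))
      ≤ (T : ℝ) ^ (m + m ^ 2) * (3 * Real.exp (-Real.log (6 * T ^ (m + m ^ 2) / δ))) := by gcongr
    _ = δ / 2 := by
      rw [Real.exp_neg, Real.exp_log (by positivity)]
      field_simp
      norm_num

theorem exists_attains_of_streamSize_le (hm : 1 ≤ m) (hα : 0 < α) (hα₁ : α ≤ 1) (hδ : 0 < δ)
    (hδ₁ : δ < 1) (X : Type u) (Y : Type v) [MeasurableSpace X] [MeasurableSpace Y]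
    [MeasurableSingletonClass Y] [Finite Y] :
    ∃ L : Learner X Y, ∀ n : ℕ, streamSize m α δ ≤ n → Learner.Attains.{u, v, w} L m n α δ := by
  have hK := explorationSize_pos hm hα hδ hδ₁
  have : NeZero (2 * explorationSize m α δ) := ⟨by omega⟩
  refine ⟨Learner.exploreThenCommit X Y m (2 * explorationSize m α δ)
    (validationSize m α δ (2 * explorationSize m α δ)), fun n hn => ?_⟩
  refine Learner.attains_exploreThenCommit hm hα hα₁ (mul_exp_explorationSize_le hm hα hδ)
    (mul_exp_validationSize_le hα hδ (by omega)) ?_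
  have h := Nat.ceil_le.1 hn
  rw [div_mul_eq_mul_div, div_le_iff₀ hα] at h
  linarith

/-- The sufficient length of the stream is `O(m² log(2/δ) log(2m/α) / α³)`. -/
theorem streamSize_le (hm : 1 ≤ m) (hα : 0 < α) (hα₁ : α ≤ 1) (hδ : 0 < δ) (hδ₁ : δ < 1) :
    (streamSize m α δ : ℝ) ≤
      6189 * (m ^ 2 * Real.log (2 / δ) / α ^ 3) * Real.log (2 * m / α) := by
  have hm' : (1 : ℝ) ≤ m := by exact_mod_cast hm
  have hm₀ : (0 : ℝ) < m := by linarith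
  set l := Real.log (2 / δ)
  set c := Real.log (2 * m / α)
  have hA : 1 ≤ m / α := (one_le_div hα).2 (hα₁.trans hm')
  -- Since `l` and `c` are at least `1 / 2`, constants and terms linear in either one are absorbed
  -- into multiples of `l * c`.
  have hl2 : (1 / 2 : ℝ) ≤ l :=
    (by linarith [Real.log_two_gt_d9] : (1 / 2 : ℝ) ≤ Real.log 2).trans
      (Real.log_le_log (by norm_num) (by rw [le_div_iff₀ hδ]; linarith))
  have hc2 : (1 / 2 : ℝ) ≤ c :=
    (by linarith [Real.log_two_gt_d9] : (1 / 2 : ℝ) ≤ Real.log 2).trans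
      (Real.log_le_log (by norm_num) (by rw [mul_div_assoc]; linarith))
  have hl_le : l ≤ 2 * (l * c) := by nlinarith
  have hc_le : c ≤ 2 * (l * c) := by nlinarith
  have h1_le : 1 ≤ 4 * (l * c) := by nlinarith
  have hlc : 0 < l * c := by linarith
  have hA2 : 1 ≤ (m / α) ^ 2 := one_le_pow₀ hA
  have hlogA : Real.log (m / α) ≤ c := Real.log_le_log (by positivity) (by gcongr; linarith)
  have hlogm : Real.log m ≤ c := by
    refine (Real.log_le_log hm₀ ?_).trans hlogA
    rw [le_div_iff₀ hα]
    nlinarith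
  have hK : (explorationSize m α δ : ℝ) ≤ 154 * (m / α) ^ 2 * (l * c) := by
    have h1 : Real.log (2 * m ^ 2 / δ) ≤ 6 * (l * c) := by
      have : 2 * (m : ℝ) ^ 2 / δ = 2 / δ * m ^ 2 := by ring
      rw [this, Real.log_mul (by positivity) (by positivity), Real.log_pow]
      push_cast
      linarith
    have h0 : 0 ≤ Real.log (2 * m ^ 2 / δ) :=
      Real.log_nonneg (by rw [le_div_iff₀ hδ]; nlinarith)
    calc (explorationSize m α δ : ℝ)
        ≤ 25 * m ^ 2 / α ^ 2 * Real.log (2 * m ^ 2 / δ) + 1 :=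
          (Nat.ceil_lt_add_one (by positivity)).le
      _ ≤ 25 * m ^ 2 / α ^ 2 * (6 * (l * c)) + (m / α) ^ 2 * (4 * (l * c)) := by
          gcongr
          nlinarith
      _ = _ := by ring
  have hK₀ : (0 : ℝ) < explorationSize m α δ := by
    exact_mod_cast explorationSize_pos hm hα hδ hδ₁
  set T := 2 * explorationSize m α δ with hT
  have hT₀ : (0 : ℝ) < T := by rw [hT]; push_cast; linarith
  have hlogT : Real.log T ≤ 32 * (l * c) := by
    have h1 : (T : ℝ) ≤ 308 * (m / α) ^ 2 * (l * c) := by rw [hT]; push_cast; linarith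
    have h308 : Real.log 308 ≤ 7 := by
      have : (308 : ℝ) ≤ 2 ^ 9 := by norm_num
      refine (Real.log_le_log (by norm_num) this).trans ?_
      rw [Real.log_pow]
      push_cast
      linarith [Real.log_two_lt_d9]
    -- The iterated logarithms in `log T` are bounded crudely, so that no further logarithmic factor
    -- appears.
    have hl0 : Real.log l ≤ l - 1 := Real.log_le_sub_one_of_pos (by linarith)
    have hc0 : Real.log c ≤ c - 1 := Real.log_le_sub_one_of_pos (by linarith)
    refine (Real.log_le_log hT₀ h1).trans ?_
    rw [Real.log_mul (by positivity) hlc.ne', Real.log_mul (by norm_num) (by positivity),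
      Real.log_pow, Real.log_mul (by linarith) (by linarith)]
    push_cast
    linarith
  have hV : (validationSize m α δ T : ℝ) ≤ 929 * (m / α) ^ 2 * (l * c) := by
    have h0 : 0 ≤ Real.log (6 * (T : ℝ) ^ (m + m ^ 2) / δ) := by
      have hT1 : (1 : ℝ) ≤ T := by exact_mod_cast (Nat.cast_pos.1 hT₀ : 0 < T)
      have := one_le_pow₀ hT1 (n := m + m ^ 2)
      exact Real.log_nonneg (by rw [le_div_iff₀ hδ]; linarith)
    have h1 : Real.log (6 * (T : ℝ) ^ (m + m ^ 2) / δ) ≤ m ^ 2 * (74 * (l * c)) := by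
      have h3 : Real.log 3 ≤ 2 := by linarith [Real.log_le_sub_one_of_pos (x := 3) (by norm_num)]
      have : 6 * (T : ℝ) ^ (m + m ^ 2) / δ = 3 * (2 / δ) * T ^ (m + m ^ 2) := by ring
      rw [this, Real.log_mul (by positivity) (by positivity), Real.log_mul (by norm_num)
        (by positivity), Real.log_pow]
      -- The exponent counting rule lists is the source of the factor `m ^ 2`.
      have hmm : ((m + m ^ 2 : ℕ) : ℝ) ≤ 2 * m ^ 2 := by push_cast; nlinarith
      have hm2 : (1 : ℝ) ≤ m ^ 2 := one_le_pow₀ hm'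
      calc Real.log 3 + l + ((m + m ^ 2 : ℕ) : ℝ) * Real.log T
          ≤ 10 * (l * c) + ((m + m ^ 2 : ℕ) : ℝ) * (32 * (l * c)) := by
            gcongr
            linarith
        _ ≤ m ^ 2 * (10 * (l * c)) + 2 * m ^ 2 * (32 * (l * c)) := by
            have h5 := mul_le_mul_of_nonneg_right hm2 hlc.le
            have h6 := mul_le_mul_of_nonneg_right hmm hlc.le
            linarith
        _ = _ := by ring
    calc (validationSize m α δ T : ℝ)
        ≤ 25 / (2 * α ^ 2) * Real.log (6 * (T : ℝ) ^ (m + m ^ 2) / δ) + 1 :=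
          (Nat.ceil_lt_add_one (by positivity)).le
      _ ≤ 25 / (2 * α ^ 2) * (m ^ 2 * (74 * (l * c))) + (m / α) ^ 2 * (4 * (l * c)) := by
          gcongr
          nlinarith
      _ = _ := by ring
  have hone : 1 ≤ 4 * (m ^ 2 * l / α ^ 3 * c) := by
    have hα' : 1 ≤ 1 / α := (one_le_div hα).2 hα₁
    calc (1 : ℝ) ≤ 4 * (l * c) := h1_le
      _ = 1 * 1 * (4 * (l * c)) := by ring
      _ ≤ (m / α) ^ 2 * (1 / α) * (4 * (l * c)) := by gcongr
      _ = _ := by field_simp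
  calc (streamSize m α δ : ℝ)
      ≤ 5 / α * ((T + validationSize m α δ T : ℕ) : ℝ) + 1 :=
        (Nat.ceil_lt_add_one (by positivity)).le
    _ ≤ 5 / α * (2 * (154 * (m / α) ^ 2 * (l * c)) + 929 * (m / α) ^ 2 * (l * c)) +
        4 * (m ^ 2 * l / α ^ 3 * c) := by
        rw [hT]
        push_cast
        gcongr
    _ = _ := by
        field_simp
        ring

end SampleSize

/-! ### Assembly of the claims. -/

theorem mainTheorem2 :
    ∃ N : ℕ → ℝ → ℝ → ℕ,
      -- the sample size is soft-O of (m ^ 4 + log (1 / δ)) / α ^ 3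
      (∃ (C : ℝ) (k : ℕ), ∀ (m : ℕ) (α δ : ℝ), 1 ≤ m → 0 < α → α ≤ 1 → 0 < δ → δ < 1 →
        (N m α δ : ℝ) ≤
          C * (((m : ℝ) ^ 4 + Real.log (1 / δ)) / α ^ 3) * Real.log (2 * m / (α * δ)) ^ k) ∧
      -- its dependence on the confidence is only linear in log (1 / δ)
      (∃ (C : ℝ) (k : ℕ), ∀ (m : ℕ) (α δ : ℝ), 1 ≤ m → 0 < α → α ≤ 1 → 0 < δ → δ < 1 →
        (N m α δ : ℝ) ≤
          C * ((m : ℝ) ^ 4 * Real.log (2 / δ) / α ^ 3) * Real.log (2 * m / α) ^ k) ∧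
      -- a single algorithm succeeds on all streams of at least that length
      (∀ (m : ℕ) (α δ : ℝ), 1 ≤ m → 0 < α → α ≤ 1 → 0 < δ → δ < 1 →
        ∀ (X : Type u) (Y : Type v) [MeasurableSpace X] [MeasurableSpace Y]
          [MeasurableSingletonClass Y] [Finite Y],
          ∃ L : Learner X Y, ∀ n : ℕ, N m α δ ≤ n → Learner.Attains.{u, v, w} L m n α δ) ∧
      -- the mistake rate converges to the exception rate
      (∀ (m : ℕ), 1 ≤ m →
        ∀ (X : Type u) (Y : Type v) [MeasurableSpace X] [MeasurableSpace Y]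
          [MeasurableSingletonClass Y] [Finite Y],
          ∃ L : ℕ → Learner X Y, ∀ α δ : ℝ, 0 < α → 0 < δ →
            ∃ n₀ : ℕ, ∀ n : ℕ, n₀ ≤ n → Learner.Attains.{u, v, w} (L n) m n α δ) := by
  refine ⟨streamSize, ⟨6189, 2, fun m α δ hm hα hα₁ hδ hδ₁ => ?_⟩,
    ⟨6189, 1, fun m α δ hm hα hα₁ hδ hδ₁ => ?_⟩, fun m α δ hm hα hα₁ hδ hδ₁ X Y _ _ _ _ =>
      exists_attains_of_streamSize_le hm hα hα₁ hδ hδ₁ X Y, fun m hm X Y _ _ _ _ => ?_⟩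
  · have hm' : (1 : ℝ) ≤ m := by exact_mod_cast hm
    have h2 : 2 ≤ 2 * m / α := by rw [le_div_iff₀ hα]; nlinarith
    have hδ' : 2 ≤ 2 / δ := by rw [le_div_iff₀ hδ]; linarith
    have hlog : 0 ≤ Real.log (1 / δ) := Real.log_nonneg (by rw [le_div_iff₀ hδ]; linarith)
    have h3 : Real.log (2 / δ) ≤ Real.log (2 * m / (α * δ)) := by
      refine Real.log_le_log (by positivity) ?_
      rw [← div_div]
      gcongr
    have h4 : Real.log (2 * m / α) ≤ Real.log (2 * m / (α * δ)) := by
      refine Real.log_le_log (by positivity) ?_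
      gcongr
      nlinarith
    have h5 : 0 ≤ Real.log (2 / δ) := Real.log_nonneg (by linarith)
    have h6 : 0 ≤ Real.log (2 * m / α) := Real.log_nonneg (by linarith)
    have h7 := h5.trans h3
    -- `streamSize` grows only like `m ^ 2`. Both logarithms are absorbed into `log (2 m / (α δ))`,
    -- which leaves room for `m ^ 4` and the added `log (1 / δ)`.
    calc (streamSize m α δ : ℝ)
        ≤ 6189 * (m ^ 2 * Real.log (2 / δ) / α ^ 3) * Real.log (2 * m / α) :=
          streamSize_le hm hα hα₁ hδ hδ₁
      _ = 6189 * (m ^ 2 / α ^ 3) * (Real.log (2 / δ) * Real.log (2 * m / α)) := by ring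
      _ ≤ 6189 * (((m : ℝ) ^ 4 + Real.log (1 / δ)) / α ^ 3) *
          (Real.log (2 * m / (α * δ)) * Real.log (2 * m / (α * δ))) := by
          gcongr
          have := pow_le_pow_right₀ hm' (by norm_num : 2 ≤ 4)
          linarith
      _ = _ := by ring
  · have hm' : (1 : ℝ) ≤ m := by exact_mod_cast hm
    have h2 : 1 ≤ 2 * m / α := by rw [le_div_iff₀ hα]; nlinarith
    have hδ' : 1 ≤ 2 / δ := by rw [le_div_iff₀ hδ]; linarith
    have h5 : 0 ≤ Real.log (2 / δ) := Real.log_nonneg hδ'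
    have h6 : 0 ≤ Real.log (2 * m / α) := Real.log_nonneg h2
    rw [pow_one]
    refine (streamSize_le hm hα hα₁ hδ hδ₁).trans ?_
    gcongr
    norm_num
  · let r : ℕ → ℝ := fun k => 1 / ((k : ℝ) + 2)
    have hr : ∀ k, 0 < r k ∧ r k < 1 := fun k => by
      have : (0 : ℝ) ≤ k := Nat.cast_nonneg k
      exact ⟨by positivity, by rw [div_lt_one (by positivity)]; linarith⟩
    choose L hL using fun k => exists_attains_of_streamSize_le.{u, v, w} hm (hr k).1 (hr k).2.le
      (hr k).1 (hr k).2 X Y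
    classical
    -- For length `n`, the accuracy is the finest `r k` with `k ≤ n` whose sample size fits in `n`.
    -- The default `0` of `findGreatest` matters only for short streams.
    refine ⟨fun n => L (Nat.findGreatest (fun k => streamSize m (r k) (r k) ≤ n) n),
      fun α δ hα hδ => ?_⟩
    obtain ⟨k, hk⟩ := exists_nat_one_div_lt (lt_min hα hδ)
    refine ⟨max k (streamSize m (r k) (r k)), fun n hn => ?_⟩
    have hkn : k ≤ n := (le_max_left _ _).trans hn
    have hP : streamSize m (r k) (r k) ≤ n := (le_max_right _ _).trans hn
    have h1 : k ≤ Nat.findGreatest (fun k => streamSize m (r k) (r k) ≤ n) n :=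
      Nat.le_findGreatest hkn hP
    have h2 := Nat.findGreatest_spec (P := fun k => streamSize m (r k) (r k) ≤ n) hkn hP
    have h3 : r (Nat.findGreatest (fun k => streamSize m (r k) (r k) ≤ n) n) ≤ min α δ := by
      refine le_trans ?_ hk.le
      have : (k : ℝ) ≤ (Nat.findGreatest (fun k => streamSize m (r k) (r k) ≤ n) n : ℕ) := by
        exact_mod_cast h1
      exact one_div_le_one_div_of_le (by positivity) (by linarith)
    exact (hL _ n h2).mono (h3.trans (min_le_left _ _)) (h3.trans (min_le_right _ _))
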